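/- Let $d\ge 1$ be an integer. A function $f:\mathbb{R}^d\to[0,\infty)$ is called log-concave if $f(ax+by)\ge f(x)^a f(y)^b$ for all $x,y\in\mathbb{R}^d$ and all $a,b\ge 0$ with $a+b=1$; it is a density if it is Lebesgue integrable with $\int_{\mathbb{R}^d} f\,dx=1$. The covariance matrix of such an $f$ is the $d\times d$ matrix with entries $$[\mathrm{Cov}(f)]_{ij}=\frac{\int_{\mathbb{R}^d} x_ix_jf(x)\,dx}{\int_{\mathbb{R}^d} f(x)\,dx}-\frac{\int_{\mathbb{R}^d} x_if(x)\,dx\,\int_{\mathbb{R}^d} x_jf(x)\,dx}{\bigl(\int_{\mathbb{R}^d} f(x)\,dx\bigr)^2}.$$ Then $$\left|\int_{\mathbb{R}^d} f\,dx-\sum_{k\in\mathbb{Z}^d}f(k)\right|=O_d\!\left(\frac1\sigma\right)\qquad(\sigma\to\infty)$$ for isotropic log-concave densities $f$ with $\mathrm{Cov}(f)=\sigma^2 I_d$. That is, there are constants $C>0$ and $N>0$ depending only on $d$ such that for every $\sigma\ge N$ and every log-concave density $f:\mathbb{R}^d\to[0,\infty)$ with $\mathrm{Cov}(f)=\sigma^2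 I_d$, the series $\sum_{k\in\mathbb{Z}^d}f(k)$ converges and $$\left|\int_{\mathbb{R}^d} f\,dx-\sum_{k\in\mathbb{Z}^d}f(k)\right|\le\frac{C}{\sigma}.$$ -/

import Mathlib

open MeasureTheory

noncomputable section

/-- A function `f` on `ℝ^d` is log-concave if `f ≥ 0` and
`f (a x + b y) ≥ f(x)^a f(y)^b` for all `x, y` and all weights `a, b ≥ 0` with `a + b = 1`;
equivalently `f = exp (-V)` with `V : ℝ^d → ℝ ∪ {+∞}` convex.
No continuity is required, and `f` may vanish on part of the space. -/
def IsLogConcaveFun {d : ℕ} (f : (Fin d → ℝ) → ℝ) : Prop :=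
  (∀ x, 0 ≤ f x) ∧
    ∀ x y : Fin d → ℝ, ∀ a b : ℝ, 0 ≤ a → 0 ≤ b → a + b = 1 →
      f x ^ a * f y ^ b ≤ f (a • x + b • y)

/-- `f` is a probability density with respect to Lebesgue measure on `ℝ^d`. -/
def IsDensityFun {d : ℕ} (f : (Fin d → ℝ) → ℝ) : Prop :=
  (∀ x, 0 ≤ f x) ∧ Integrable f ∧ ∫ x, f x = 1

/-- The covariance matrix of a nonnegative function on `ℝ^d`, normalised by its integral. -/
def covMatrixFun {d : ℕ} (f : (Fin d → ℝ) → ℝ) : Matrix (Fin d) (Fin d) ℝ :=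
  Matrix.of fun i j =>
    (∫ x, x i * x j * f x) / (∫ x, f x) -
      (∫ x, x i * f x) * (∫ x, x j * f x) / (∫ x, f x) ^ 2

end

/-! Superlevel sets of a quasiconcave function of one variable are intervals, and the number of
integers in an interval differs from its length by at most one. Integrating over levels, its sum and
its integral differ by at most its supremum. In `d` variables the integral is turned into a sum one
coordinate at a time. If `f` lies below `A` times a product of profiles bounded by 1, each with
integral and sum at most `S`, every exchange costs at most `A * S ^ (d - 1)`
(`QuasiconcaveOn.abs_integral_sub_tsum_pi_int_le`).

With `M = sup f`, it is enough to find such an envelope with `A` of order `M` and `S` of order `σ`,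
and to show that `M` is at most of order `σ ^ (-d)`: the error is then of order `M * σ ^ (d - 1)`,
that is `1 / σ`.

Envelope: by Chebyshev each coordinate slab of half-width `2σ` has mass at least 3/4. A point far
from a slab cannot have a value near `M`, since contracting the slab towards it would put too much
mass outside. Log-concavity on segments from a near-maximum turns this into exponential decay
(`IsLogConcaveFun.le_exp_of_slab`).

Maximum: if all points with value comparable to `M` lay in a thin slab, the variance across it would
be too small. So there are such points at distance of order `σ` in every direction
(`IsLogConcaveFun.exists_far_point`). They span a simplex of volume of order at least `σ ^ d` on
which `f` is comparable to `M`, while `∫ f = 1`. -/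

/-- A quasiconcave function on a finite-dimensional space is almost everywhere measurable. -/
theorem QuasiconcaveOn.aemeasurable_univ {E : Type*} [NormedAddCommGroup E] [NormedSpace ℝ E]
    [MeasurableSpace E] [BorelSpace E] [FiniteDimensional ℝ E] {μ : Measure E}
    [μ.IsAddHaarMeasure] {f : E → ℝ} (hf : QuasiconcaveOn ℝ Set.univ f) : AEMeasurable f μ := by
  have h : NullMeasurable f μ := by
    -- A convex set need not be Borel, but it is null measurable, so measurability is tested in the
    -- completed σ-algebra.
    have : @Measurable (NullMeasurableSpace E μ) ℝ _ _ f := by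
      refine measurable_of_Ioi fun r => ?_
      have h1 := (hf.convex_gt r).nullMeasurableSet μ
      simp only [Set.mem_univ, true_and] at h1
      exact h1
    exact this
  exact h.aemeasurable

/-! ### Sum versus integral in one variable -/

/-- The number of integers in an interval is at most its length plus one. -/
theorem Set.OrdConnected.encard_int_le_volume_add_one {s : Set ℝ} (hs : s.OrdConnected) :
    (({k : ℤ | (k : ℝ) ∈ s}.encard : ℕ∞) : ENNReal) ≤ volume s + 1 := by
  have key : ∀ F : Finset ℤ, (F : Set ℤ) ⊆ {k : ℤ | (k : ℝ) ∈ s} →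
      (F.card : ENNReal) ≤ volume s + 1 := by
    intro F hF
    rcases F.eq_empty_or_nonempty with rfl | hne
    · simp
    have h1 : F ⊆ Finset.Icc (F.min' hne) (F.max' hne) := fun k hk =>
      Finset.mem_Icc.2 ⟨F.min'_le k hk, F.le_max' k hk⟩
    have h2 := Finset.card_le_card h1
    have hle : F.min' hne ≤ F.max' hne := F.min'_le _ (F.max'_mem hne)
    rw [Int.card_Icc] at h2
    have h3 : Set.Icc ((F.min' hne : ℤ) : ℝ) ((F.max' hne : ℤ) : ℝ) ⊆ s :=
      hs.out (hF (F.min'_mem hne)) (hF (F.max'_mem hne))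
    have h4 := measure_mono (μ := volume) h3
    rw [Real.volume_Icc] at h4
    calc (F.card : ENNReal) ≤ ENNReal.ofReal (((F.max' hne : ℤ) : ℝ) - (F.min' hne : ℤ) + 1) := by
          rw [← ENNReal.ofReal_natCast]
          apply ENNReal.ofReal_le_ofReal
          have : (F.card : ℤ) ≤ F.max' hne - F.min' hne + 1 := by omega
          exact_mod_cast this
      _ = ENNReal.ofReal (((F.max' hne : ℤ) : ℝ) - (F.min' hne : ℤ)) + 1 := by
          rw [ENNReal.ofReal_add _ zero_le_one, ENNReal.ofReal_one]
          rw [sub_nonneg]; exact_mod_cast hle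
      _ ≤ _ := by gcongr
  by_cases hfin : {k : ℤ | (k : ℝ) ∈ s}.Finite
  · rw [hfin.encard_eq_coe_toFinset_card]
    simpa using key hfin.toFinset (by simp)
  · have : volume s + 1 = ⊤ := by
      by_contra h
      obtain ⟨n, hn⟩ := ENNReal.exists_nat_gt h
      obtain ⟨F, hF, hc⟩ := Set.Infinite.exists_subset_card_eq hfin n
      exact absurd (key F hF) (by rw [hc]; exact not_le.2 hn)
    rw [this]; exact le_top

/-- The length of an interval is at most the number of integers in it plus one. -/
theorem Set.OrdConnected.volume_le_encard_int_add_one {s : Set ℝ} (hs : s.OrdConnected) :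
    volume s ≤ (({k : ℤ | (k : ℝ) ∈ s}.encard : ℕ∞) : ENNReal) + 1 := by
  by_cases hfin : {k : ℤ | (k : ℝ) ∈ s}.Finite
  swap
  · rw [Set.Infinite.encard_eq hfin]; simp
  rcases Set.eq_empty_or_nonempty {k : ℤ | (k : ℝ) ∈ s} with he | hne
  · rw [he]
    rcases s.eq_empty_or_nonempty with rfl | ⟨x, hx⟩
    · simp
    have hsub : s ⊆ Set.Icc (⌊x⌋ : ℝ) (⌊x⌋ + 1) := by
      intro y hy
      constructor
      · by_contra h
        have : (⌊x⌋ : ℝ) ∈ s := hs.out hy hx ⟨(not_le.1 h).le, Int.floor_le x⟩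
        have h' : ⌊x⌋ ∈ {k : ℤ | (k : ℝ) ∈ s} := this
        rw [he] at h'; exact h'
      · by_contra h
        have : ((⌊x⌋ + 1 : ℤ) : ℝ) ∈ s := hs.out hx hy
          ⟨by push_cast; exact (Int.lt_floor_add_one x).le, by push_cast; exact (not_le.1 h).le⟩
        have h' : ⌊x⌋ + 1 ∈ {k : ℤ | (k : ℝ) ∈ s} := this
        rw [he] at h'; exact h'
    simpa using measure_mono (μ := volume) hsub
  · have hne' : hfin.toFinset.Nonempty := by simpa using hne
    set a := hfin.toFinset.min' hne'
    set b := hfin.toFinset.max' hne'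
    have ha : (a : ℝ) ∈ s := by simpa using hfin.toFinset.min'_mem hne'
    have hb : (b : ℝ) ∈ s := by simpa using hfin.toFinset.max'_mem hne'
    have hamin : ∀ k : ℤ, (k : ℝ) ∈ s → a ≤ k := fun k hk =>
      hfin.toFinset.min'_le k (by simpa using hk)
    have hbmax : ∀ k : ℤ, (k : ℝ) ∈ s → k ≤ b := fun k hk =>
      hfin.toFinset.le_max' k (by simpa using hk)
    have hab : a ≤ b := hamin b hb
    -- With `b - a + 1` integers inside, the enclosing interval has length `b - a + 2`: one more
    -- than the count.
    have hsub : s ⊆ Set.Icc ((a : ℝ) - 1) (b + 1) := by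
      intro y hy
      constructor
      · by_contra h
        have : ((a - 1 : ℤ) : ℝ) ∈ s := hs.out hy ha
          ⟨by push_cast; exact (not_le.1 h).le, by push_cast; linarith⟩
        have := hamin _ this
        omega
      · by_contra h
        have : ((b + 1 : ℤ) : ℝ) ∈ s := hs.out hb hy
          ⟨by push_cast; linarith, by push_cast; exact (not_le.1 h).le⟩
        have := hbmax _ this
        omega
    have h1 : Finset.Icc a b ⊆ hfin.toFinset := by
      intro k hk
      rw [Finset.mem_Icc] at hk
      simpa using hs.out ha hb ⟨by exact_mod_cast hk.1, by exact_mod_cast hk.2⟩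
    have h2 := Finset.card_le_card h1
    rw [Int.card_Icc] at h2
    rw [hfin.encard_eq_coe_toFinset_card]
    refine (measure_mono hsub).trans ?_
    rw [Real.volume_Icc]
    have h3 : (b : ℝ) + 1 - (a - 1) ≤ (hfin.toFinset.card + 1 : ℕ) := by
      have : b + 1 - (a - 1) ≤ ((hfin.toFinset.card + 1 : ℕ) : ℤ) := by omega
      exact_mod_cast this
    refine (ENNReal.ofReal_le_ofReal h3).trans ?_
    rw [ENNReal.ofReal_natCast]
    simp

/-- The integral and the sum over the integers of a bounded quasiconcave function of one real
variable differ by at most its bound. -/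
theorem QuasiconcaveOn.abs_integral_sub_tsum_int_le {g : ℝ → ℝ} {B : ℝ}
    (hg : QuasiconcaveOn ℝ Set.univ g) (h0 : ∀ x, 0 ≤ g x) (hB : ∀ x, g x ≤ B)
    (hint : Integrable g) :
    Summable (fun k : ℤ => g k) ∧ |(∫ x, g x) - ∑' k : ℤ, g k| ≤ B := by
  have hB0 : 0 ≤ B := (h0 0).trans (hB 0)
  have hoc : ∀ t, ({x | t < g x} : Set ℝ).OrdConnected := fun t => by
    have := (hg.convex_gt t).ordConnected
    simpa using this
  -- Layer cake, for Lebesgue measure here and for counting measure on `ℤ` next.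
  have hI : ∫⁻ x, ENNReal.ofReal (g x) = ∫⁻ t in Set.Ioi (0 : ℝ), volume {x | t < g x} :=
    lintegral_eq_lintegral_meas_lt volume (Filter.Eventually.of_forall h0)
      hint.aestronglyMeasurable.aemeasurable
  have hS : ∑' k : ℤ, ENNReal.ofReal (g k) =
      ∫⁻ t in Set.Ioi (0 : ℝ), (({k : ℤ | (k : ℝ) ∈ {x | t < g x}}.encard : ℕ∞) : ENNReal) := by
    rw [← lintegral_count, lintegral_eq_lintegral_meas_lt Measure.count
      (Filter.Eventually.of_forall fun k : ℤ => h0 k) Measurable.of_discrete.aemeasurable]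
    refine lintegral_congr fun t => ?_
    rw [Measure.count_apply (MeasurableSet.of_discrete)]
    rfl
  -- Levels above `B` contribute nothing, so the error of one per level integrates to `B`.
  have hcut : ∀ F : ℝ → ENNReal, (∀ t, B ≤ t → F t = 0) →
      ∫⁻ t in Set.Ioi (0 : ℝ), F t = ∫⁻ t in Set.Ioo (0 : ℝ) B, F t := by
    intro F hF
    rw [← lintegral_indicator measurableSet_Ioi, ← lintegral_indicator measurableSet_Ioo]
    refine lintegral_congr fun t => ?_
    by_cases h1 : 0 < t
    · by_cases h2 : t < B
      · simp [h1, h2]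
      · simp [h1, h2, hF t (not_lt.1 h2)]
    · simp [h1]
  have hem : ∀ t, B ≤ t → {x | t < g x} = ∅ := fun t ht => by
    ext x; simpa using (hB x).trans ht
  rw [hcut _ fun t ht => by rw [hem t ht]; simp] at hI
  rw [hcut _ fun t ht => by rw [hem t ht]; simp] at hS
  have hone : ∫⁻ _ in Set.Ioo (0 : ℝ) B, (1 : ENNReal) = ENNReal.ofReal B := by simp
  have hm1 : Antitone fun t => volume {x | t < g x} := fun s t hst =>
    measure_mono fun x (hx : t < g x) => lt_of_le_of_lt hst hx
  have hm2 : Antitone fun t => (({k : ℤ | (k : ℝ) ∈ {x | t < g x}}.encard : ℕ∞) : ENNReal) :=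
    fun s t hst => by
      have : {k : ℤ | (k : ℝ) ∈ {x | t < g x}} ⊆ {k : ℤ | (k : ℝ) ∈ {x | s < g x}} :=
        fun x (hx : t < g x) => lt_of_le_of_lt hst hx
      exact ENat.toENNReal_le.2 (Set.encard_le_encard this)
  have h1 : ∑' k : ℤ, ENNReal.ofReal (g k) ≤ (∫⁻ x, ENNReal.ofReal (g x)) + ENNReal.ofReal B := by
    rw [hS, hI, ← hone, ← lintegral_add_left hm1.measurable]
    exact lintegral_mono fun t => (hoc t).encard_int_le_volume_add_one
  have h2 : ∫⁻ x, ENNReal.ofReal (g x) ≤ (∑' k : ℤ, ENNReal.ofReal (g k)) + ENNReal.ofReal B := by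
    rw [hS, hI, ← hone, ← lintegral_add_left hm2.measurable]
    exact lintegral_mono fun t => (hoc t).volume_le_encard_int_add_one
  have hofI := ofReal_integral_eq_lintegral_ofReal hint (Filter.Eventually.of_forall h0)
  rw [← hofI] at h1 h2
  have hne : ∑' k : ℤ, ENNReal.ofReal (g k) ≠ ⊤ :=
    ne_top_of_le_ne_top (by simp) h1
  have hsum : Summable (fun k : ℤ => g k) := by
    have := ENNReal.summable_toReal hne
    simpa [ENNReal.toReal_ofReal (h0 _)] using this
  refine ⟨hsum, ?_⟩
  have hS0 : 0 ≤ ∑' k : ℤ, g k := tsum_nonneg fun k => h0 k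
  have hI0 : 0 ≤ ∫ x, g x := integral_nonneg h0
  rw [← ENNReal.ofReal_tsum_of_nonneg (fun k : ℤ => h0 k) hsum] at h1 h2
  rw [← ENNReal.ofReal_add hI0 hB0, ENNReal.ofReal_le_ofReal_iff (by positivity)] at h1
  rw [← ENNReal.ofReal_add hS0 hB0, ENNReal.ofReal_le_ofReal_iff (by positivity)] at h2
  rw [abs_le]; constructor <;> linarith

/-! ### Sum versus integral in several variables -/

theorem QuasiconcaveOn.comp_of_combo {E F : Type*} [AddCommGroup E] [Module ℝ E] [AddCommGroup F]
    [Module ℝ F] {f : F → ℝ} (hf : QuasiconcaveOn ℝ Set.univ f) (L : E → F)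
    (hL : ∀ x y (a b : ℝ), a + b = 1 → L (a • x + b • y) = a • L x + b • L y) :
    QuasiconcaveOn ℝ Set.univ fun x => f (L x) := by
  rw [quasiconcaveOn_iff_min_le] at hf ⊢
  refine ⟨convex_univ, fun x _ y _ a b ha hb hab => ?_⟩
  rw [hL x y a b hab]
  exact hf.2 (Set.mem_univ _) (Set.mem_univ _) ha hb hab

theorem QuasiconcaveOn.cons_left {d : ℕ} {f : (Fin (d + 1) → ℝ) → ℝ}
    (hf : QuasiconcaveOn ℝ Set.univ f) (t : ℝ) :
    QuasiconcaveOn ℝ Set.univ fun x : Fin d → ℝ => f (Fin.cons t x) := by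
  refine hf.comp_of_combo _ fun x y a b hab => ?_
  funext i
  refine Fin.cases ?_ (fun j => ?_) i
  · simp [← add_mul, hab]
  · simp

theorem QuasiconcaveOn.cons_right {d : ℕ} {f : (Fin (d + 1) → ℝ) → ℝ}
    (hf : QuasiconcaveOn ℝ Set.univ f) (x : Fin d → ℝ) :
    QuasiconcaveOn ℝ Set.univ fun t : ℝ => f (Fin.cons t x) := by
  refine hf.comp_of_combo _ fun s t a b hab => ?_
  funext i
  refine Fin.cases ?_ (fun j => ?_) i
  · simp
  · simp [← add_mul, hab]

theorem integrable_of_quasiconcaveOn_of_le {E : Type*} [NormedAddCommGroup E] [NormedSpace ℝ E]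
    [MeasurableSpace E] [BorelSpace E] [FiniteDimensional ℝ E] {μ : Measure E}
    [μ.IsAddHaarMeasure] {f g : E → ℝ} (hf : QuasiconcaveOn ℝ Set.univ f) (h0 : ∀ x, 0 ≤ f x)
    (hfg : ∀ x, f x ≤ g x) (hg : Integrable g μ) : Integrable f μ :=
  hg.mono' hf.aemeasurable_univ.aestronglyMeasurable
    (Filter.Eventually.of_forall fun x => by rw [Real.norm_of_nonneg (h0 x)]; exact hfg x)

theorem integrable_and_integral_cons {d : ℕ} {f : (Fin (d + 1) → ℝ) → ℝ} (hf : Integrable f) :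
    Integrable (fun p : ℝ × (Fin d → ℝ) => f (Fin.cons p.1 p.2)) (volume.prod volume) ∧
    ∫ x, f x = ∫ p : ℝ × (Fin d → ℝ), f (Fin.cons p.1 p.2) ∂(volume.prod volume) := by
  have e := (volume_preserving_piFinSuccAbove (fun _ : Fin (d + 1) => ℝ) 0).symm
  have h : ∀ p : ℝ × (Fin d → ℝ),
      (MeasurableEquiv.piFinSuccAbove (fun _ : Fin (d + 1) => ℝ) 0).symm p = Fin.cons p.1 p.2 := by
    intro p
    rw [MeasurableEquiv.piFinSuccAbove_symm_apply]
    exact Fin.insertNth_zero' p.1 p.2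
  constructor
  · have := (e.integrable_comp_emb (MeasurableEquiv.measurableEmbedding _) (g := f)).2 hf
    simp only [Function.comp_def, h] at this
    exact this
  · have := e.integral_comp' (g := f)
    simp only [h] at this
    exact this.symm

theorem integrable_tsum_of_nonneg {α : Type*} [MeasurableSpace α] {μ : Measure α}
    {F : ℤ → α → ℝ} {g : α → ℝ} (hF : ∀ k, AEMeasurable (F k) μ) (h0 : ∀ k x, 0 ≤ F k x)
    (hs : ∀ x, Summable fun k => F k x) (hle : ∀ x, ∑' k, F k x ≤ g x) (hg : Integrable g μ) :
    Integrable (fun x => ∑' k, F k x) μ := by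
  have h : (fun x => ∑' k, F k x) = fun x => (∑' k, ENNReal.ofReal (F k x)).toReal := by
    funext x
    rw [← ENNReal.ofReal_tsum_of_nonneg (fun k => h0 k x) (hs x),
      ENNReal.toReal_ofReal (tsum_nonneg fun k => h0 k x)]
  refine hg.mono' ?_ (Filter.Eventually.of_forall fun x => ?_)
  · rw [h]
    exact (AEMeasurable.tsum fun k => (hF k).ennreal_ofReal).ennreal_toReal
      |>.aestronglyMeasurable
  · rw [Real.norm_of_nonneg (tsum_nonneg fun k => h0 k x)]
    exact hle x

/-- The integral and the lattice sum of a quasiconcave function dominated by a product. -/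
theorem QuasiconcaveOn.abs_integral_sub_tsum_pi_int_le {S : ℝ} (hS : 0 ≤ S) (d : ℕ) :
    ∀ (f : (Fin d → ℝ) → ℝ) (φ : Fin d → ℝ → ℝ) (A : ℝ),
      QuasiconcaveOn ℝ Set.univ f → (∀ x, 0 ≤ f x) → 0 ≤ A →
      (∀ i t, 0 ≤ φ i t) → (∀ i t, φ i t ≤ 1) → (∀ i, Integrable (φ i)) →
      (∀ i, ∫ t, φ i t ≤ S) → (∀ i, Summable fun k : ℤ => φ i k) →
      (∀ i, ∑' k : ℤ, φ i k ≤ S) → (∀ x, f x ≤ A * ∏ i, φ i (x i)) →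
      Summable (fun k : Fin d → ℤ => f fun i => (k i : ℝ)) ∧
      |(∫ x, f x) - ∑' k : Fin d → ℤ, f fun i => (k i : ℝ)| ≤ d * A * S ^ (d - 1) := by
  induction d with
  | zero =>
    intro f φ A _ _ _ _ _ _ _ _ _ _
    refine ⟨(hasSum_fintype _).summable, ?_⟩
    rw [tsum_fintype, Measure.volume_pi_eq_dirac, integral_dirac]
    rw [Finset.univ_unique, Finset.sum_singleton]
    simp only [Nat.cast_zero, zero_mul, abs_nonpos_iff]
    exact sub_eq_zero.2 (congrArg f (Subsingleton.elim _ _))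
  | succ d ih =>
    intro f φ A hf h0 hA hφ0 hφ1 hφi hφS hφs hφsS hle
    have hcast : ∀ (k : ℤ) (l : Fin d → ℤ),
        (fun i => ((Fin.cons k l : Fin (d + 1) → ℤ) i : ℝ)) = Fin.cons (k : ℝ) fun i => (l i : ℝ) := by
      intro k l
      funext i
      refine Fin.cases ?_ (fun j => ?_) i <;> simp
    have hle' : ∀ t x, f (Fin.cons t x) ≤ A * φ 0 t * ∏ i : Fin d, φ i.succ (x i) := by
      intro t x
      have := hle (Fin.cons t x)
      rw [Fin.prod_univ_succ] at this
      simpa [mul_assoc] using this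
    have hle1 : ∀ t x, f (Fin.cons t x) ≤ A * ∏ i : Fin d, φ i.succ (x i) := by
      intro t x
      refine (hle' t x).trans ?_
      have : 0 ≤ ∏ i : Fin d, φ i.succ (x i) := Finset.prod_nonneg fun i _ => hφ0 _ _
      have h2 := mul_le_mul_of_nonneg_left (hφ1 0 t) hA
      rw [mul_one] at h2
      exact mul_le_mul_of_nonneg_right h2 this
    have hprodi : Integrable fun x : Fin d → ℝ => ∏ i : Fin d, φ i.succ (x i) := by
      have := Integrable.fintype_prod_dep (f := fun (i : Fin d) => φ i.succ) fun i => hφi i.succ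
      exact this
    have hprodS : ∫ x : Fin d → ℝ, ∏ i : Fin d, φ i.succ (x i) ≤ S ^ d := by
      rw [integral_fintype_prod_volume_eq_prod (fun (i : Fin d) => φ i.succ)]
      calc ∏ i : Fin d, ∫ x, φ i.succ x ≤ ∏ _i : Fin d, S :=
            Finset.prod_le_prod (fun i _ => integral_nonneg (hφ0 _)) fun i _ => hφS _
        _ = S ^ d := by simp
    have hfi : Integrable f := by
      refine integrable_of_quasiconcaveOn_of_le hf h0 hle (Integrable.const_mul ?_ A)
      exact Integrable.fintype_prod_dep (f := φ) hφi
    obtain ⟨hpi, hpe⟩ := integrable_and_integral_cons hfi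
    have hsl : ∀ t, Integrable fun x : Fin d → ℝ => f (Fin.cons t x) := fun t =>
      integrable_of_quasiconcaveOn_of_le (hf.cons_left t) (fun x => h0 _) (hle' t)
        (hprodi.const_mul _)
    have hsr : ∀ x : Fin d → ℝ, Integrable fun t => f (Fin.cons t x) := fun x =>
      integrable_of_quasiconcaveOn_of_le (g := fun t => A * φ 0 t * ∏ i : Fin d, φ i.succ (x i))
        (hf.cons_right x) (fun x => h0 _) (fun t => hle' t x)
        (((hφi 0).const_mul _).mul_const _)
    -- The slice at `t` has amplitude `A * φ 0 t`, so the errors of the integer slices are summable.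
    have IH : ∀ t : ℝ, _ := fun t => ih (fun x => f (Fin.cons t x)) (fun i => φ i.succ) (A * φ 0 t)
      (hf.cons_left t) (fun x => h0 _) (mul_nonneg hA (hφ0 0 t)) (fun i => hφ0 _) (fun i => hφ1 _)
      (fun i => hφi _) (fun i => hφS _) (fun i => hφs _) (fun i => hφsS _) (hle' t)
    -- For `d = 0` the exponent `d - 1` truncates to 0; the factor `d` saves the identity.
    have hdS : (d : ℝ) * S ^ (d - 1) * S = d * S ^ d := by
      cases d with
      | zero => simp
      | succ n => simp [pow_succ, mul_assoc]
    have one : ∀ x : Fin d → ℝ, _ := fun x =>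
      (hf.cons_right x).abs_integral_sub_tsum_int_le (fun t => h0 _) (fun t => hle1 t x) (hsr x)
    -- the integrals over slices
    have hH0 : ∀ t, 0 ≤ ∫ x : Fin d → ℝ, f (Fin.cons t x) := fun t => integral_nonneg fun x => h0 _
    have hHle : ∀ t, ∫ x : Fin d → ℝ, f (Fin.cons t x) ≤ A * φ 0 t * S ^ d := by
      intro t
      calc _ ≤ ∫ x : Fin d → ℝ, A * φ 0 t * ∏ i : Fin d, φ i.succ (x i) :=
            integral_mono (hsl t) (hprodi.const_mul _) (hle' t)
        _ ≤ _ := by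
            rw [integral_const_mul]
            exact mul_le_mul_of_nonneg_left hprodS (mul_nonneg hA (hφ0 0 t))
    have hHs : Summable fun k : ℤ => ∫ x : Fin d → ℝ, f (Fin.cons (k : ℝ) x) :=
      Summable.of_nonneg_of_le (fun k => hH0 k) (fun k => hHle k)
        (((hφs 0).mul_left A).mul_right (S ^ d))
    -- the sums over slices
    have hGH : ∀ k : ℤ, |(∫ x : Fin d → ℝ, f (Fin.cons (k : ℝ) x)) -
        ∑' l : Fin d → ℤ, f (Fin.cons (k : ℝ) fun i => (l i : ℝ))| ≤
        d * A * S ^ (d - 1) * φ 0 k := fun k => by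
      refine (IH k).2.trans (le_of_eq ?_)
      ring
    have hbs : Summable fun k : ℤ => d * A * S ^ (d - 1) * φ 0 k := (hφs 0).mul_left _
    have hGHs : Summable fun k : ℤ => (∫ x : Fin d → ℝ, f (Fin.cons (k : ℝ) x)) -
        ∑' l : Fin d → ℤ, f (Fin.cons (k : ℝ) fun i => (l i : ℝ)) :=
      Summable.of_norm_bounded hbs hGH
    have hGs : Summable fun k : ℤ => ∑' l : Fin d → ℤ, f (Fin.cons (k : ℝ) fun i => (l i : ℝ)) := by
      simpa using hHs.sub hGHs
    have hprods : Summable fun p : ℤ × (Fin d → ℤ) =>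
        f (Fin.cons (p.1 : ℝ) fun i => (p.2 i : ℝ)) :=
      (summable_prod_of_nonneg fun p => h0 _).2 ⟨fun k => (IH k).1, hGs⟩
    have hcomp : ((fun k : Fin (d + 1) → ℤ => f fun i => (k i : ℝ)) ∘
        Fin.consEquiv fun _ : Fin (d + 1) => ℤ) = fun p : ℤ × (Fin d → ℤ) =>
        f (Fin.cons (p.1 : ℝ) fun i => (p.2 i : ℝ)) := by
      funext p
      simp only [Function.comp_apply, Fin.consEquiv_apply]
      rw [hcast]
    have hsum : Summable fun k : Fin (d + 1) → ℤ => f fun i => (k i : ℝ) := by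
      rw [← (Fin.consEquiv fun _ : Fin (d + 1) => ℤ).summable_iff, hcomp]
      exact hprods
    refine ⟨hsum, ?_⟩
    have hts : ∑' k : Fin (d + 1) → ℤ, f (fun i => (k i : ℝ)) =
        ∑' k : ℤ, ∑' l : Fin d → ℤ, f (Fin.cons (k : ℝ) fun i => (l i : ℝ)) := by
      rw [← (Fin.consEquiv fun _ : Fin (d + 1) => ℤ).tsum_eq, ← hprods.tsum_prod]
      exact tsum_congr fun p => congrFun hcomp p
    have first : |∑' k : ℤ, ((∫ x : Fin d → ℝ, f (Fin.cons (k : ℝ) x)) -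
        ∑' l : Fin d → ℤ, f (Fin.cons (k : ℝ) fun i => (l i : ℝ)))| ≤ d * A * S ^ d := by
      rw [← Real.norm_eq_abs]
      refine (tsum_of_norm_bounded hbs.hasSum hGH).trans ?_
      calc ∑' k : ℤ, d * A * S ^ (d - 1) * φ 0 k ≤ d * A * S ^ (d - 1) * S := by
            rw [tsum_mul_left]
            exact mul_le_mul_of_nonneg_left (hφsS 0) (by positivity)
        _ = A * (d * S ^ (d - 1) * S) := by ring
        _ = _ := by rw [hdS]; ring
    -- exchanging the sum over the first coordinate and the integral over the others
    have hI : Integrable fun x : Fin d → ℝ => ∫ t, f (Fin.cons t x) := hpi.integral_prod_right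
    have hT : Integrable fun x : Fin d → ℝ => ∑' k : ℤ, f (Fin.cons (k : ℝ) x) := by
      refine integrable_tsum_of_nonneg (fun k => (hf.cons_left (k : ℝ)).aemeasurable_univ)
        (fun k x => h0 _) (fun x => (one x).1) (fun x => ?_) (hI.add (hprodi.const_mul A))
      have := abs_le.1 (one x).2
      simp only [Pi.add_apply]
      linarith [this.1]
    have hswap := hasSum_integral_of_summable_integral_norm
      (F := fun (k : ℤ) (x : Fin d → ℝ) => f (Fin.cons (k : ℝ) x)) (μ := volume)
      (fun k => hsl k) (by simpa only [Real.norm_of_nonneg (h0 _)] using hHs)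
    -- The one-variable bound on each line, integrated over the other coordinates; with `first` this
    -- gives `d + 1` terms `A * S ^ d`.
    have second : |(∫ x, f x) - ∑' k : ℤ, ∫ x : Fin d → ℝ, f (Fin.cons (k : ℝ) x)| ≤
        A * S ^ d := by
      rw [hswap.tsum_eq, hpe, integral_prod_symm _ hpi, ← integral_sub hI hT]
      rw [← Real.norm_eq_abs]
      refine (norm_integral_le_of_norm_le (hprodi.const_mul A)
        (Filter.Eventually.of_forall fun x => (one x).2)).trans ?_
      rw [integral_const_mul]
      exact mul_le_mul_of_nonneg_left hprodS hA
    rw [hts]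
    rw [hHs.tsum_sub hGs] at first
    have := abs_sub_le (∫ x, f x) (∑' k : ℤ, ∫ x : Fin d → ℝ, f (Fin.cons (k : ℝ) x))
      (∑' k : ℤ, ∑' l : Fin d → ℤ, f (Fin.cons (k : ℝ) fun i => (l i : ℝ)))
    refine this.trans ((add_le_add second first).trans (le_of_eq ?_))
    simp only [Nat.add_sub_cancel]
    push_cast
    ring

/-! ### Log-concave densities: the square root and boundedness -/

theorem integrable_and_integral_comp_homothety {d : ℕ} {f : (Fin d → ℝ) → ℝ} (hf : Integrable f)
    {c : ℝ} (hc : 0 < c) (v : Fin d → ℝ) :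
    Integrable (fun x => f (c • x + v)) ∧ c ^ d * ∫ x, f (c • x + v) = ∫ x, f x := by
  have h1 : Integrable fun x => f (x + v) := hf.comp_add_right v
  refine ⟨(integrable_comp_smul_iff volume (fun x => f (x + v)) hc.ne').2 h1, ?_⟩
  rw [Measure.integral_comp_smul volume (fun x => f (x + v)) c, integral_add_right_eq_self f v]
  have : 0 < c ^ d := by positivity
  simp only [Module.finrank_fintype_fun_eq_card, Fintype.card_fin, smul_eq_mul]
  rw [abs_of_pos (by positivity)]
  field_simp

namespace IsLogConcaveFun

variable {d : ℕ} {f : (Fin d → ℝ) → ℝ}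

theorem quasiconcaveOn (hf : IsLogConcaveFun f) : QuasiconcaveOn ℝ Set.univ f := by
  rw [quasiconcaveOn_iff_min_le]
  refine ⟨convex_univ, fun x _ y _ a b ha hb hab => ?_⟩
  refine le_trans ?_ (hf.2 x y a b ha hb hab)
  have h0 : 0 ≤ min (f x) (f y) := le_min (hf.1 x) (hf.1 y)
  calc min (f x) (f y) = min (f x) (f y) ^ (a + b) := by rw [hab, Real.rpow_one]
    _ = min (f x) (f y) ^ a * min (f x) (f y) ^ b := by
        rw [Real.rpow_add_of_nonneg h0 ha hb]
    _ ≤ f x ^ a * f y ^ b := by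
        gcongr
        · exact Real.rpow_nonneg (hf.1 x) a
        · exact min_le_left _ _
        · exact min_le_right _ _

theorem sqrt_mul_sqrt_le (hf : IsLogConcaveFun f) (y z : Fin d → ℝ) :
    √(f y) * √(f z) ≤ f ((1 / 2 : ℝ) • y + (1 / 2 : ℝ) • z) := by
  rw [Real.sqrt_eq_rpow, Real.sqrt_eq_rpow]
  exact hf.2 y z _ _ (by norm_num) (by norm_num) (by norm_num)

/-- Midpoint log-concavity bounds `√f` by a multiple of a homothetic copy of `f`. -/
theorem integrable_sqrt (hf : IsLogConcaveFun f) (hi : Integrable f) {z : Fin d → ℝ}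
    (hz : 0 < f z) : Integrable fun y => √(f y) := by
  have h := (integrable_and_integral_comp_homothety hi (c := 1 / 2) (by norm_num)
    ((1 / 2 : ℝ) • z)).1
  refine (h.const_mul (√(f z))⁻¹).mono' ?_ (Filter.Eventually.of_forall fun y => ?_)
  · exact (Real.continuous_sqrt.measurable.comp_aemeasurable
      hi.aestronglyMeasurable.aemeasurable).aestronglyMeasurable
  · rw [Real.norm_of_nonneg (Real.sqrt_nonneg _)]
    have hs := Real.sqrt_pos.2 hz
    rw [inv_mul_eq_div, le_div_iff₀ hs]
    exact hf.sqrt_mul_sqrt_le y z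

theorem integral_sqrt_mul_sqrt_le (hf : IsLogConcaveFun f) (hi : Integrable f)
    (h1 : ∫ x, f x = 1) {z : Fin d → ℝ} (hz : 0 < f z) :
    (∫ y, √(f y)) * √(f z) ≤ 2 ^ d := by
  obtain ⟨ha, hb⟩ := integrable_and_integral_comp_homothety hi (c := 1 / 2) (by norm_num)
    ((1 / 2 : ℝ) • z)
  rw [h1] at hb
  have hb' : ∫ x, f ((1 / 2 : ℝ) • x + (1 / 2 : ℝ) • z) = 2 ^ d := by
    rw [one_div, inv_pow, inv_mul_eq_div, div_eq_one_iff_eq (by positivity)] at hb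
    rw [one_div]; exact hb
  rw [← hb', ← integral_mul_const]
  exact integral_mono ((hf.integrable_sqrt hi hz).mul_const _) ha fun y => hf.sqrt_mul_sqrt_le y z

/-- The integral of `√f` is positive and its product with `√(f z)` is at most `2 ^ d`, which bounds
`f z`. -/
theorem bddAbove (hf : IsLogConcaveFun f) (hi : Integrable f) (h1 : ∫ x, f x = 1) :
    BddAbove (Set.range f) := by
  obtain ⟨z, hz⟩ : ∃ z, 0 < f z := by
    by_contra! h
    have : ∫ x, f x ≤ 0 := integral_nonpos h
    linarith
  have hpos : 0 < ∫ y, √(f y) := by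
    rw [integral_pos_iff_support_of_nonneg (fun y => Real.sqrt_nonneg _)
      (hf.integrable_sqrt hi hz)]
    have h2 : 0 < ∫ x, f x := by rw [h1]; exact one_pos
    rw [integral_pos_iff_support_of_nonneg (fun y => hf.1 y) hi] at h2
    convert h2 using 2
    ext y
    simp [Real.sqrt_eq_zero (hf.1 y)]
  refine ⟨(2 ^ d / ∫ y, √(f y)) ^ 2, ?_⟩
  rintro _ ⟨x, rfl⟩
  rcases (hf.1 x).eq_or_lt with h | h
  · rw [← h]; positivity
  · rw [← Real.sqrt_le_left (by positivity), le_div_iff₀ hpos, mul_comm]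
    exact hf.integral_sqrt_mul_sqrt_le hi h1 h

/-! ### Exponential decay away from a slab -/

/-- Contracting towards a point where a log-concave function is large keeps a part of its mass. -/
theorem setIntegral_contraction_le (hf : IsLogConcaveFun f) (hi : Integrable f) {M : ℝ}
    (hM0 : 0 < M) (hM : ∀ x, f x ≤ M) {A B : Set (Fin d → ℝ)} (hA : MeasurableSet A)
    (hB : MeasurableSet B) {z : Fin d → ℝ} {s : ℝ} (hs0 : 0 < s) (hs1 : s < 1)
    (hAB : ∀ y ∈ A, (1 - s) • y + s • z ∈ B) :
    (1 - s) ^ d * ((f z / M) ^ s * ∫ x in A, f x) ≤ ∫ x in B, f x := by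
  have h1s : 0 < 1 - s := by linarith
  have hiB : Integrable (B.indicator f) := hi.indicator hB
  obtain ⟨ha, hb⟩ := integrable_and_integral_comp_homothety hiB h1s (s • z)
  rw [← integral_indicator hB, ← hb, ← integral_indicator hA, ← integral_const_mul]
  refine mul_le_mul_of_nonneg_left ?_ (by positivity)
  refine integral_mono ((hi.indicator hA).const_mul _) ha fun y => ?_
  by_cases hy : y ∈ A
  · simp only [Set.indicator_of_mem hy, Set.indicator_of_mem (hAB y hy)]
    refine le_trans ?_ (hf.2 y z (1 - s) s h1s.le hs0.le (by ring))
    rw [Real.div_rpow (hf.1 z) hM0.le]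
    -- Log-concavity yields only the power `f y ^ (1 - s)`; the missing `f y ^ s` is paid for by `M
    -- ^ s`.
    have h2 : f y = f y ^ (1 - s) * f y ^ s := by
      rw [← Real.rpow_add_of_nonneg (hf.1 y) h1s.le hs0.le]; simp
    have h3 : f y ^ s ≤ M ^ s := Real.rpow_le_rpow (hf.1 y) (hM y) hs0.le
    have h4 : 0 < M ^ s := Real.rpow_pos_of_pos hM0 s
    have h5 : 0 ≤ f y ^ (1 - s) := Real.rpow_nonneg (hf.1 y) _
    have h6 : 0 ≤ f z ^ s := Real.rpow_nonneg (hf.1 z) _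
    calc f z ^ s / M ^ s * f y = f z ^ s * f y ^ (1 - s) * (f y ^ s / M ^ s) := by
          conv_lhs => rw [h2]
          ring
      _ ≤ f z ^ s * f y ^ (1 - s) * 1 := by
          gcongr
          rwa [div_le_one h4]
      _ = _ := by ring
  · simp only [Set.indicator_of_notMem hy, mul_zero]
    exact Set.indicator_nonneg (fun x _ => hf.1 x) _

/-- Were `z` farther away, contraction towards `z` would carry the slab off itself while keeping
more than 1/4 of the total mass, but at most 1/4 lies outside. -/
theorem abs_sub_lt_of_slab (hf : IsLogConcaveFun f) (hd : 1 ≤ d) (hi : Integrable f)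
    (h1 : ∫ x, f x = 1) {M : ℝ} (hM0 : 0 < M) (hM : ∀ x, f x ≤ M)
    (l : (Fin d → ℝ) →ₗ[ℝ] ℝ) {a w : ℝ}
    (hslab : 3 / 4 ≤ ∫ x in {x | |l x - a| < w}, f x) {z : Fin d → ℝ}
    (hz : M * (3 / 4) ^ (2 * d) ≤ f z) : |l z - a| < 4 * d * w := by
  by_contra! hcon
  have hd0 : (0 : ℝ) < d := by exact_mod_cast hd
  have hd1 : (1 : ℝ) ≤ d := by exact_mod_cast hd
  -- This ratio gives both `(1 - s) ^ d ≥ 1/2` and `(f z / M) ^ s ≥ 3/4`.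
  set s : ℝ := 1 / (2 * d) with hs
  have hs0 : 0 < s := by positivity
  have hs2 : s ≤ 1 / 2 := by
    rw [hs]; apply one_div_le_one_div_of_le <;> linarith
  have hlc : Continuous fun x => |l x - a| :=
    (l.continuous_of_finiteDimensional.sub continuous_const).abs
  have hA : MeasurableSet {x | |l x - a| < w} := (isOpen_lt hlc continuous_const).measurableSet
  have hc := hf.setIntegral_contraction_le hi hM0 hM hA hA.compl (z := z) hs0 (by linarith) (by
    intro y hy
    simp only [Set.mem_ofPred_eq, Set.mem_compl_iff, not_lt] at hy ⊢
    have e : l ((1 - s) • y + s • z) - a = s * (l z - a) + (1 - s) * (l y - a) := by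
      simp only [map_add, map_smul, smul_eq_mul]; ring
    have e1 : 2 * w ≤ s * |l z - a| := by
      calc 2 * w = s * (4 * d * w) := by rw [hs]; field_simp; ring
        _ ≤ _ := by gcongr
    have e2 : (1 - s) * |l y - a| ≤ |l y - a| := by nlinarith [abs_nonneg (l y - a)]
    have e3 := abs_sub_abs_le_abs_add (s * (l z - a)) ((1 - s) * (l y - a))
    rw [abs_mul, abs_mul, abs_of_pos hs0, abs_of_pos (by linarith : 0 < 1 - s)] at e3
    rw [e]; linarith)
  have htot := integral_add_compl hA hi
  rw [h1] at htot
  have hq : (3 / 4 : ℝ) ≤ (f z / M) ^ s := by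
    have : (3 / 4 : ℝ) ^ (2 * d) ≤ f z / M := by rw [le_div_iff₀ hM0, mul_comm]; exact hz
    calc (3 / 4 : ℝ) = ((3 / 4 : ℝ) ^ (2 * d)) ^ s := by
          rw [← Real.rpow_natCast, ← Real.rpow_mul (by norm_num), hs]
          push_cast
          rw [mul_one_div_cancel (by positivity), Real.rpow_one]
      _ ≤ _ := Real.rpow_le_rpow (by positivity) this hs0.le
  have hp : (1 / 2 : ℝ) ≤ (1 - s) ^ d := by
    have := one_add_mul_le_pow (a := -s) (by linarith) d
    have e : (d : ℝ) * s = 1 / 2 := by rw [hs]; field_simp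
    calc (1 / 2 : ℝ) = 1 + d * -s := by rw [mul_neg, e]; norm_num
      _ ≤ _ := this
      _ = _ := by ring
  -- The mass kept is at least 9/32, more than 1/4.
  have : (1 / 2 : ℝ) * (3 / 4 * (3 / 4)) ≤
      (1 - s) ^ d * ((f z / M) ^ s * ∫ x in {x | |l x - a| < w}, f x) := by gcongr
  linarith

/-- A log-concave density with most of its mass in a slab decays exponentially away from it. -/
theorem le_exp_of_slab (hf : IsLogConcaveFun f) (hd : 1 ≤ d) (hi : Integrable f)
    (h1 : ∫ x, f x = 1) {M : ℝ} (hM0 : 0 < M) (hM : ∀ x, f x ≤ M) {x₀ : Fin d → ℝ}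
    (hx₀ : M ≤ (4 / 3) ^ d * f x₀) (l : (Fin d → ℝ) →ₗ[ℝ] ℝ) {a w : ℝ} (hw : 0 < w)
    (hslab : 3 / 4 ≤ ∫ x in {x | |l x - a| < w}, f x) (z : Fin d → ℝ) :
    f z ≤ M * (4 / 3) ^ d * Real.exp (-(Real.log (4 / 3) / 8 / w * |l z - a|)) := by
  have hd0 : (0 : ℝ) < d := by exact_mod_cast hd
  have hL : 0 < Real.log (4 / 3) := Real.log_pos (by norm_num)
  set L := Real.log (4 / 3) with hLdef
  have hK : ((4 / 3 : ℝ)) ^ d = Real.exp (d * L) := by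
    rw [Real.exp_nat_mul, hLdef, Real.exp_log (by norm_num)]
  have hK' : ((3 / 4 : ℝ)) ^ (2 * d) = Real.exp (-(2 * d * L)) := by
    rw [Real.exp_neg, show (2 * d * L : ℝ) = (2 * d : ℕ) * L by push_cast; ring, Real.exp_nat_mul,
      hLdef, Real.exp_log (by norm_num), ← inv_pow]
    norm_num
  have hK1 : 1 ≤ (4 / 3 : ℝ) ^ d := one_le_pow₀ (by norm_num)
  have hsep := fun z hz => hf.abs_sub_lt_of_slab hd hi h1 hM0 hM l hslab (z := z) hz
  rcases (hf.1 z).eq_or_lt with hz0 | hz0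
  · rw [← hz0]; positivity
  have hfx0 : 0 < f x₀ := by
    by_contra! h
    have : (4 / 3 : ℝ) ^ d * f x₀ ≤ 0 := mul_nonpos_of_nonneg_of_nonpos (by positivity) h
    linarith
  -- At distance below `8 * d * w` the prefactor `(4 / 3) ^ d` outweighs the exponential.
  rcases lt_or_ge |l z - a| (8 * d * w) with hH | hH
  · have : 1 ≤ (4 / 3 : ℝ) ^ d * Real.exp (-(L / 8 / w * |l z - a|)) := by
      rw [hK, ← Real.exp_add, Real.one_le_exp_iff]
      have : L / 8 / w * |l z - a| ≤ L / 8 / w * (8 * d * w) := by gcongr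
      have e : L / 8 / w * (8 * d * w) = d * L := by field_simp
      linarith
    calc f z ≤ M * 1 := by rw [mul_one]; exact hM z
      _ ≤ M * ((4 / 3 : ℝ) ^ d * Real.exp (-(L / 8 / w * |l z - a|))) := by gcongr
      _ = _ := by ring
  · have hHpos : 0 < |l z - a| := lt_of_lt_of_le (by positivity) hH
    -- The point at fraction `t` from `x₀` to `z` is at least `8dw - 4dw = 4dw` from the centre, so
    -- `f` has dropped below `M * (3 / 4) ^ (2 * d)` there; concavity of `log f` extrapolates the
    -- drop to `z`.
    set t := 8 * d * w / |l z - a| with ht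
    have ht0 : 0 < t := by positivity
    have ht1 : t ≤ 1 := by rw [ht, div_le_one hHpos]; exact hH
    have hx0l : |l x₀ - a| < 4 * d * w := by
      apply hsep
      have : (3 / 4 : ℝ) ^ (2 * d) ≤ (3 / 4 : ℝ) ^ d :=
        pow_le_pow_of_le_one (by norm_num) (by norm_num) (by omega)
      calc M * (3 / 4) ^ (2 * d) ≤ ((4 / 3) ^ d * f x₀) * (3 / 4) ^ d := by gcongr
        _ = ((4 / 3) * (3 / 4)) ^ d * f x₀ := by rw [mul_pow]; ring
        _ = f x₀ := by norm_num
    have hyt : f ((1 - t) • x₀ + t • z) < M * (3 / 4) ^ (2 * d) := by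
      by_contra! h
      have h2 := hsep _ h
      have e : l ((1 - t) • x₀ + t • z) - a = t * (l z - a) + (1 - t) * (l x₀ - a) := by
        simp only [map_add, map_smul, smul_eq_mul]; ring
      have e3 := abs_sub_abs_le_abs_add (t * (l z - a)) ((1 - t) * (l x₀ - a))
      rw [abs_mul, abs_mul, abs_of_pos ht0, abs_of_nonneg (by linarith : 0 ≤ 1 - t)] at e3
      have e4 : t * |l z - a| = 8 * d * w := by rw [ht]; field_simp
      have e5 : (1 - t) * |l x₀ - a| ≤ |l x₀ - a| := by nlinarith [abs_nonneg (l x₀ - a)]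
      rw [e] at h2
      linarith
    have hlog := (hf.2 x₀ z (1 - t) t (by linarith) ht0.le (by ring)).trans_lt hyt
    have hlog2 := Real.log_lt_log (by positivity) hlog
    rw [Real.log_mul (by positivity) (by positivity), Real.log_mul (by positivity) (by positivity),
      Real.log_rpow hfx0, Real.log_rpow hz0, hK', Real.log_exp] at hlog2
    have hlx := Real.log_le_log hM0 hx₀
    rw [hK, Real.log_mul (Real.exp_pos _).ne' hfx0.ne', Real.log_exp] at hlx
    have h3 : (1 - t) * (Real.log M - d * L) ≤ (1 - t) * Real.log (f x₀) := by
      gcongr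
      · linarith
    have h4 : t * (Real.log (f z) - Real.log M) ≤ -(d * L) := by
      have : 0 ≤ t * (d * L) := by positivity
      nlinarith
    have h5 : Real.log (f z) - Real.log M ≤ -(L / 8 / w * |l z - a|) := by
      rw [mul_comm, ← le_div_iff₀ ht0] at h4
      refine h4.trans (le_of_eq ?_)
      rw [ht]; field_simp
    calc f z = M * Real.exp (Real.log (f z) - Real.log M) := by
          rw [Real.exp_sub, Real.exp_log hz0, Real.exp_log hM0]; field_simp
      _ ≤ M * Real.exp (-(L / 8 / w * |l z - a|)) := by gcongr
      _ ≤ M * (4 / 3) ^ d * Real.exp (-(L / 8 / w * |l z - a|)) := by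
          gcongr
          nlinarith

end IsLogConcaveFun

/-! ### Variance across a thin slab -/

namespace IsLogConcaveFun

variable {d : ℕ} {f : (Fin d → ℝ) → ℝ}

theorem sqrt_mul_integral_sqrt_le (hf : IsLogConcaveFun f) (hi : Integrable f)
    (h1 : ∫ x, f x = 1) {M : ℝ} (hM0 : 0 < M) {x₀ : Fin d → ℝ}
    (hx₀ : M ≤ (4 / 3) ^ d * f x₀) :
    (Integrable fun y => √(f y)) ∧ √M * ∫ y, √(f y) ≤ (8 / 3) ^ d := by
  have hfx0 : 0 < f x₀ := by
    by_contra! h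
    have : (4 / 3 : ℝ) ^ d * f x₀ ≤ 0 := mul_nonpos_of_nonneg_of_nonpos (by positivity) h
    linarith
  refine ⟨hf.integrable_sqrt hi hfx0, ?_⟩
  have hK1 : 1 ≤ (4 / 3 : ℝ) ^ d := one_le_pow₀ (by norm_num)
  have hI : 0 ≤ ∫ y, √(f y) := integral_nonneg fun y => Real.sqrt_nonneg _
  have hsM : √M ≤ (4 / 3) ^ d * √(f x₀) := by
    rw [Real.sqrt_le_left (by positivity), mul_pow, Real.sq_sqrt hfx0.le]
    refine hx₀.trans ?_
    gcongr
    nlinarith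
  calc √M * ∫ y, √(f y) ≤ ((4 / 3) ^ d * √(f x₀)) * ∫ y, √(f y) := by gcongr
    _ = (4 / 3) ^ d * ((∫ y, √(f y)) * √(f x₀)) := by ring
    _ ≤ (4 / 3) ^ d * 2 ^ d := by
        gcongr
        exact hf.integral_sqrt_mul_sqrt_le hi h1 hfx0
    _ = (8 / 3) ^ d := by rw [← mul_pow]; norm_num

/-- A log-concave density with most of its mass in a thin slab has a small variance across it. -/
theorem integral_sq_le_of_slab (hf : IsLogConcaveFun f) (hd : 1 ≤ d) (hi : Integrable f)
    (h1 : ∫ x, f x = 1) {M : ℝ} (hM0 : 0 < M) (hM : ∀ x, f x ≤ M) {x₀ : Fin d → ℝ}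
    (hx₀ : M ≤ (4 / 3) ^ d * f x₀) (l : (Fin d → ℝ) →ₗ[ℝ] ℝ) {a w : ℝ} (hw : 0 < w)
    (hslab : 3 / 4 ≤ ∫ x in {x | |l x - a| < w}, f x) :
    ∫ x, (l x - a) ^ 2 * f x ≤ 512 * 4 ^ d / Real.log (4 / 3) ^ 2 * w ^ 2 := by
  have hL : 0 < Real.log (4 / 3) := Real.log_pos (by norm_num)
  have hdec := hf.le_exp_of_slab hd hi h1 hM0 hM hx₀ l hw hslab
  obtain ⟨hsi, hsI⟩ := hf.sqrt_mul_integral_sqrt_le hi h1 hM0 hx₀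
  set L := Real.log (4 / 3)
  set c := L / 8 / w with hc
  have hc0 : 0 < c := by positivity
  -- Split `f = √f * √f`: the decay of one factor absorbs the quadratic weight, the other is
  -- integrated.
  have hpt : ∀ x, (l x - a) ^ 2 * f x ≤ 8 / c ^ 2 * (√M * (4 / 3) ^ d) * √(f x) := by
    intro x
    set H := |l x - a| with hH
    have hH0 : 0 ≤ H := abs_nonneg _
    have e1 : √(f x) ≤ √M * (4 / 3) ^ d * Real.exp (-(c * H / 2)) := by
      rw [Real.sqrt_le_left (by positivity), mul_pow, mul_pow, Real.sq_sqrt hM0.le,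
        ← Real.exp_nat_mul]
      refine (hdec x).trans ?_
      have : ((2 : ℕ) : ℝ) * -(c * H / 2) = -(c * H) := by push_cast; ring
      rw [this]
      gcongr
      have : 1 ≤ (4 / 3 : ℝ) ^ d := one_le_pow₀ (by norm_num)
      nlinarith
    have e2 : H ^ 2 * Real.exp (-(c * H / 2)) ≤ 8 / c ^ 2 := by
      have := Real.quadratic_le_exp_of_nonneg (x := c * H / 2) (by positivity)
      rw [Real.exp_neg, mul_inv_le_iff₀ (Real.exp_pos _)]
      have e3 : (c * H / 2) ^ 2 / 2 ≤ Real.exp (c * H / 2) := by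
        have : 0 ≤ c * H / 2 := by positivity
        linarith
      calc H ^ 2 = 8 / c ^ 2 * ((c * H / 2) ^ 2 / 2) := by field_simp; norm_num
        _ ≤ _ := by gcongr
    calc (l x - a) ^ 2 * f x = H ^ 2 * (√(f x) * √(f x)) := by
          rw [hH, sq_abs, Real.mul_self_sqrt (hf.1 x)]
      _ ≤ H ^ 2 * (√M * (4 / 3) ^ d * Real.exp (-(c * H / 2)) * √(f x)) := by gcongr
      _ = (H ^ 2 * Real.exp (-(c * H / 2))) * (√M * (4 / 3) ^ d) * √(f x) := by ring
      _ ≤ _ := by gcongr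
  calc ∫ x, (l x - a) ^ 2 * f x ≤ ∫ x, 8 / c ^ 2 * (√M * (4 / 3) ^ d) * √(f x) :=
        integral_mono_of_nonneg
          (Filter.Eventually.of_forall fun x => mul_nonneg (sq_nonneg _) (hf.1 x))
          (hsi.const_mul _) (Filter.Eventually.of_forall hpt)
    _ = 8 / c ^ 2 * (4 / 3) ^ d * (√M * ∫ x, √(f x)) := by rw [integral_const_mul]; ring
    _ ≤ 8 / c ^ 2 * (4 / 3) ^ d * (8 / 3) ^ d := by gcongr
    _ = 8 / c ^ 2 * (32 / 9) ^ d := by rw [mul_assoc, ← mul_pow]; norm_num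
    _ ≤ 8 / c ^ 2 * 4 ^ d := by gcongr; norm_num
    _ = _ := by rw [hc]; field_simp; norm_num

/-- Where `f` is small, `f ≤ ε * √M * √f`, and `√M * ∫ √f` is bounded in terms of `d` alone. -/
theorem setIntegral_lt_le (hf : IsLogConcaveFun f) (hi : Integrable f)
    (h1 : ∫ x, f x = 1) {M : ℝ} (hM0 : 0 < M) {x₀ : Fin d → ℝ}
    (hx₀ : M ≤ (4 / 3) ^ d * f x₀) {B : Set (Fin d → ℝ)} (hB : MeasurableSet B) {ε : ℝ}
    (hε : 0 ≤ ε) (hBε : ∀ x ∈ B, f x ≤ ε ^ 2 * M) : ∫ x in B, f x ≤ ε * (8 / 3) ^ d := by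
  obtain ⟨hsi, hsI⟩ := hf.sqrt_mul_integral_sqrt_le hi h1 hM0 hx₀
  calc ∫ x in B, f x ≤ ∫ x in B, ε * √M * √(f x) := by
        refine setIntegral_mono_on hi.integrableOn (hsi.const_mul _).integrableOn hB fun x hx => ?_
        have : √(f x) ≤ ε * √M := by
          rw [Real.sqrt_le_left (by positivity), mul_pow, Real.sq_sqrt hM0.le]
          exact hBε x hx
        calc f x = √(f x) * √(f x) := (Real.mul_self_sqrt (hf.1 x)).symm
          _ ≤ _ := by gcongr
    _ ≤ ∫ x, ε * √M * √(f x) := setIntegral_le_integral (hsi.const_mul _)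
        (Filter.Eventually.of_forall fun x => by positivity)
    _ = ε * (√M * ∫ x, √(f x)) := by rw [integral_const_mul]; ring
    _ ≤ _ := by gcongr

end IsLogConcaveFun

/-! ### Second moments from the covariance matrix -/

section Moments

variable {d : ℕ} {f : (Fin d → ℝ) → ℝ} {σ : ℝ}

/-- A divergent second moment has integral 0 by convention, making the diagonal covariance entry
nonpositive, against `σ ^ 2 > 0`. -/
theorem integrable_sq_mul_of_covMatrixFun (hσ : 0 < σ)
    (h1 : ∫ x, f x = 1)
    (hcov : covMatrixFun f = σ ^ 2 • (1 : Matrix (Fin d) (Fin d) ℝ)) (i : Fin d) :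
    Integrable fun x => x i * x i * f x := by
  by_contra h
  have := congrFun (congrFun hcov i) i
  simp only [covMatrixFun, Matrix.of_apply, h1, integral_undef h, Matrix.smul_apply,
    Matrix.one_apply_eq, smul_eq_mul] at this
  nlinarith [mul_self_nonneg (∫ x, x i * f x), sq_pos_of_pos hσ]

theorem integral_sq_sub_mul (h0 : ∀ x, 0 ≤ f x) (hi : Integrable f) (hσ : 0 < σ)
    (h1 : ∫ x, f x = 1)
    (hcov : covMatrixFun f = σ ^ 2 • (1 : Matrix (Fin d) (Fin d) ℝ))
    (l : (Fin d → ℝ) →ₗ[ℝ] ℝ) (a : ℝ) :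
    (Integrable fun x => (l x - a) ^ 2 * f x) ∧
    ∫ x, (l x - a) ^ 2 * f x =
      σ ^ 2 * ∑ i, l (Pi.single i 1) ^ 2 + (l (fun i => ∫ x, x i * f x) - a) ^ 2 := by
  have hsq := integrable_sq_mul_of_covMatrixFun hσ h1 hcov
  have hij : ∀ i j, Integrable fun x : Fin d → ℝ => x i * x j * f x := by
    intro i j
    refine ((hsq i).add (hsq j)).mono' ?_ (Filter.Eventually.of_forall fun x => ?_)
    · exact (by fun_prop : Continuous fun x : Fin d → ℝ => x i * x j).aestronglyMeasurable.mul
        hi.aestronglyMeasurable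
    · rw [Real.norm_eq_abs, abs_mul, abs_of_nonneg (h0 x), Pi.add_apply, ← add_mul]
      refine mul_le_mul_of_nonneg_right ?_ (h0 x)
      rw [abs_le]; constructor <;> nlinarith [sq_nonneg (x i - x j), sq_nonneg (x i + x j)]
  have hone : ∀ i, Integrable fun x : Fin d → ℝ => x i * f x := by
    intro i
    refine (hi.add (hsq i)).mono' ?_ (Filter.Eventually.of_forall fun x => ?_)
    · exact (by fun_prop : Continuous fun x : Fin d → ℝ => x i).aestronglyMeasurable.mul
        hi.aestronglyMeasurable
    · rw [Real.norm_eq_abs, abs_mul, abs_of_nonneg (h0 x), Pi.add_apply, ← one_add_mul]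
      refine mul_le_mul_of_nonneg_right ?_ (h0 x)
      rw [abs_le]; constructor <;> nlinarith [sq_nonneg (x i - 1), sq_nonneg (x i + 1)]
  have hcij : ∀ i j, ∫ x, x i * x j * f x =
      σ ^ 2 * (if i = j then 1 else 0) + (∫ x, x i * f x) * ∫ x, x j * f x := by
    intro i j
    have := congrFun (congrFun hcov i) j
    simp only [covMatrixFun, Matrix.of_apply, h1, Matrix.smul_apply, Matrix.one_apply,
      smul_eq_mul, div_one, one_pow] at this
    linarith
  set n : Fin d → ℝ := fun i => l (Pi.single i 1) with hn
  set m : Fin d → ℝ := fun i => ∫ x, x i * f x with hm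
  have hl : ∀ x, l x = ∑ i, n i * x i := by
    intro x
    rw [LinearMap.pi_apply_eq_sum_univ l x]
    refine Finset.sum_congr rfl fun i _ => ?_
    rw [smul_eq_mul, mul_comm, hn]
    congr 2
    funext j
    simp [Pi.single_apply, eq_comm]
  have hexp : (fun x => (l x - a) ^ 2 * f x) = fun x =>
      (∑ i, ∑ j, n i * n j * (x i * x j * f x)) - 2 * a * (∑ i, n i * (x i * f x)) +
        a ^ 2 * f x := by
    funext x
    have e1 : (∑ i, ∑ j, n i * n j * (x i * x j * f x)) = (l x) ^ 2 * f x := by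
      rw [hl, sq, Finset.sum_mul_sum, Finset.sum_mul]
      refine Finset.sum_congr rfl fun i _ => ?_
      rw [Finset.sum_mul]
      exact Finset.sum_congr rfl fun j _ => by ring
    have e2 : (∑ i, n i * (x i * f x)) = l x * f x := by
      rw [hl, Finset.sum_mul]
      exact Finset.sum_congr rfl fun j _ => by ring
    rw [e1, e2]; ring
  have i1 : Integrable fun x : Fin d → ℝ => ∑ i, ∑ j, n i * n j * (x i * x j * f x) :=
    integrable_finsetSum _ fun i _ => integrable_finsetSum _ fun j _ => (hij i j).const_mul _
  have i2 : Integrable fun x : Fin d → ℝ => 2 * a * ∑ i, n i * (x i * f x) :=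
    (integrable_finsetSum _ fun i _ => (hone i).const_mul _).const_mul _
  have i3 : Integrable fun x : Fin d → ℝ => a ^ 2 * f x := hi.const_mul _
  have i12 : Integrable fun x : Fin d → ℝ => (∑ i, ∑ j, n i * n j * (x i * x j * f x)) -
      2 * a * ∑ i, n i * (x i * f x) := i1.sub i2
  rw [hexp]
  refine ⟨i12.add i3, ?_⟩
  rw [integral_add i12 i3, integral_sub i1 i2, integral_const_mul, integral_const_mul,
    integral_finsetSum _ fun i _ => (hone i).const_mul _,
    integral_finsetSum _ fun i _ => integrable_finsetSum _ fun j _ => (hij i j).const_mul _, h1]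
  have e3 : ∀ i, ∫ x, ∑ j, n i * n j * (x i * x j * f x) =
      σ ^ 2 * n i ^ 2 + n i * m i * ∑ j, n j * m j := by
    intro i
    rw [integral_finsetSum _ fun j _ => (hij i j).const_mul _]
    simp_rw [integral_const_mul, hcij]
    have : ∀ j, n i * n j * (σ ^ 2 * (if i = j then 1 else 0) + m i * m j) =
        (if i = j then σ ^ 2 * n i * n j else 0) + n i * m i * (n j * m j) := by
      intro j; split_ifs <;> ring
    rw [Finset.sum_congr rfl fun j _ => this j, Finset.sum_add_distrib, ← Finset.mul_sum]
    simp
    ring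
  simp_rw [e3, integral_const_mul]
  rw [Finset.sum_add_distrib, ← Finset.mul_sum, ← Finset.sum_mul, hl m]
  ring

end Moments

/-! ### The maximum is at most of order `σ ^ (-d)` -/

namespace IsLogConcaveFun

variable {d : ℕ} {f : (Fin d → ℝ) → ℝ} {σ : ℝ}

/-- In every direction there is a point, far from `x₀`, at which an isotropic log-concave density
is comparable with its maximum. -/
theorem exists_far_point (hf : IsLogConcaveFun f) (hd : 1 ≤ d) (hi : Integrable f)
    (h1 : ∫ x, f x = 1) (hσ : 0 < σ)
    (hcov : covMatrixFun f = σ ^ 2 • (1 : Matrix (Fin d) (Fin d) ℝ))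
    {M : ℝ} (hM0 : 0 < M) (hM : ∀ x, f x ≤ M) {x₀ : Fin d → ℝ}
    (hx₀ : M ≤ (4 / 3) ^ d * f x₀) (l : (Fin d → ℝ) →ₗ[ℝ] ℝ) (i : Fin d)
    (hl : l (Pi.single i 1) ≠ 0) :
    ∃ u, (1 / (8 * (8 / 3) ^ d)) ^ 2 * M ≤ f (x₀ + u) ∧
      Real.log (4 / 3) / (64 * 2 ^ d) * σ * |l (Pi.single i 1)| ≤ |l u| := by
  by_contra! hcon
  have hL : 0 < Real.log (4 / 3) := Real.log_pos (by norm_num)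
  set L := Real.log (4 / 3) with hLdef
  set w := L / (64 * 2 ^ d) * σ * |l (Pi.single i 1)| with hw
  have hn : 0 < |l (Pi.single i 1)| := abs_pos.2 hl
  have hw0 : 0 < w := by positivity
  -- With this `ε` the mass outside the slab is at most 1/8; the width `w` makes the variance bound
  -- 1/8 of `σ ^ 2 * l (Pi.single i 1) ^ 2`, below the true second moment.
  set ε : ℝ := 1 / (8 * (8 / 3) ^ d) with hε
  have hA : MeasurableSet {x | |l x - l x₀| < w} := by
    have hlc : Continuous fun x => |l x - l x₀| :=
      (l.continuous_of_finiteDimensional.sub continuous_const).abs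
    exact (isOpen_lt hlc continuous_const).measurableSet
  have hB := hf.setIntegral_lt_le hi h1 hM0 hx₀ hA.compl (ε := ε) (by positivity) (by
    intro x hx
    by_contra! h
    have := hcon (x - x₀) (by rw [add_sub_cancel]; exact h.le)
    rw [map_sub] at this
    exact hx this)
  have htot := integral_add_compl hA hi
  rw [h1] at htot
  have hε8 : ε * (8 / 3) ^ d = 1 / 8 := by rw [hε]; field_simp
  have hvar := hf.integral_sq_le_of_slab hd hi h1 hM0 hM hx₀ l hw0 (a := l x₀) (by linarith)
  rw [(integral_sq_sub_mul hf.1 hi hσ h1 hcov l (l x₀)).2] at hvar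
  have hsum : l (Pi.single i 1) ^ 2 ≤ ∑ j, l (Pi.single j 1) ^ 2 :=
    Finset.single_le_sum (f := fun j => l (Pi.single j 1) ^ 2) (fun j _ => sq_nonneg _)
      (Finset.mem_univ i)
  have hsum' : σ ^ 2 * l (Pi.single i 1) ^ 2 ≤ σ ^ 2 * ∑ j, l (Pi.single j 1) ^ 2 := by gcongr
  have e : 512 * 4 ^ d / L ^ 2 * w ^ 2 = 1 / 8 * (σ ^ 2 * l (Pi.single i 1) ^ 2) := by
    rw [hw, mul_pow, mul_pow, sq_abs, div_pow, mul_pow, ← pow_mul, mul_comm d 2, pow_mul]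
    norm_num
    field_simp
    norm_num
  have hpos : 0 < σ ^ 2 * l (Pi.single i 1) ^ 2 := by positivity
  rw [e] at hvar
  nlinarith [sq_nonneg (l (fun i => ∫ x, x i * f x) - l x₀)]

/-- Rows of the identity are replaced one by one. The determinant as a function of row `i` is a
linear form with value `V.det` at the old row, so a far point for this form multiplies the bound by
order `σ`. -/
theorem exists_matrix_det_ge (hf : IsLogConcaveFun f) (hd : 1 ≤ d) (hi : Integrable f)
    (h1 : ∫ x, f x = 1) (hσ : 0 < σ)
    (hcov : covMatrixFun f = σ ^ 2 • (1 : Matrix (Fin d) (Fin d) ℝ))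
    {M : ℝ} (hM0 : 0 < M) (hM : ∀ x, f x ≤ M) {x₀ : Fin d → ℝ}
    (hx₀ : M ≤ (4 / 3) ^ d * f x₀) (s : Finset (Fin d)) :
    ∃ V : Matrix (Fin d) (Fin d) ℝ,
      (∀ i ∈ s, (1 / (8 * (8 / 3) ^ d)) ^ 2 * M ≤ f (x₀ + V i)) ∧
      (∀ i ∉ s, V i = Pi.single i 1) ∧
      (Real.log (4 / 3) / (64 * 2 ^ d) * σ) ^ s.card ≤ |V.det| := by
  have hL : 0 < Real.log (4 / 3) := Real.log_pos (by norm_num)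
  induction s using Finset.induction_on with
  | empty =>
    refine ⟨1, by simp, fun i _ => ?_, by simp⟩
    funext j
    simp [Matrix.one_apply, Pi.single_apply, eq_comm]
  | insert i s his ih =>
    obtain ⟨V, hV1, hV2, hV3⟩ := ih
    let l : (Fin d → ℝ) →ₗ[ℝ] ℝ :=
      (Matrix.detRowAlternating (n := Fin d) (R := ℝ)).toMultilinearMap.toLinearMap V i
    have hl : ∀ u, l u = (V.updateRow i u).det := fun u => rfl
    have hli : l (Pi.single i 1) = V.det := by
      rw [hl, ← hV2 i his, Matrix.updateRow_eq_self]
    have hdet : 0 < |V.det| := lt_of_lt_of_le (by positivity) hV3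
    obtain ⟨u, hu1, hu2⟩ := hf.exists_far_point hd hi h1 hσ hcov hM0 hM hx₀ l i
      (by rw [hli]; exact abs_pos.1 hdet)
    refine ⟨V.updateRow i u, fun j hj => ?_, fun j hj => ?_, ?_⟩
    · rcases eq_or_ne j i with rfl | hji
      · rw [Matrix.updateRow_self]; exact hu1
      · rw [Matrix.updateRow_ne hji]
        exact hV1 j (Finset.mem_of_mem_insert_of_ne hj hji)
    · rw [Finset.mem_insert, not_or] at hj
      rw [Matrix.updateRow_ne hj.1]
      exact hV2 j hj.2
    · rw [Finset.card_insert_of_notMem his, pow_succ', ← hl]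
      rw [hli] at hu2
      exact le_trans (by gcongr) hu2

/-- The convex set `{δ ≤ f}` contains the simplex on `x₀` and the `x₀ + V i`, hence the image of the
cube `[0, 1/d]^d`, whose volume is explicit; Markov's inequality concludes. -/
theorem mul_le_one_of_matrix (hf : IsLogConcaveFun f) (hi : Integrable f)
    (h1 : ∫ x, f x = 1) {δ : ℝ} {x₀ : Fin d → ℝ} (hx₀ : δ ≤ f x₀)
    (hδ : 0 ≤ δ) (V : Matrix (Fin d) (Fin d) ℝ) (hV : ∀ i, δ ≤ f (x₀ + V i)) :
    δ * (|V.det| * (1 / d) ^ d) ≤ 1 := by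
  rcases Nat.eq_zero_or_pos d with rfl | hd
  · have : ∫ x, f x = f x₀ := by
      rw [Measure.volume_pi_eq_dirac x₀, integral_dirac]
    simp
    linarith
  have hd0 : (0 : ℝ) < d := by exact_mod_cast hd
  have hconv : Convex ℝ {x | δ ≤ f x} := by simpa using hf.quasiconcaveOn δ
  set box : Set (Fin d → ℝ) := Set.Icc 0 (fun _ => 1 / (d : ℝ)) with hbox
  have hsub : Matrix.toLin' V.transpose '' box ⊆ (fun y => x₀ + y) ⁻¹' {x | δ ≤ f x} := by
    rintro _ ⟨t, ht, rfl⟩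
    have hsum : ∑ i, t i ≤ 1 := by
      calc ∑ i, t i ≤ ∑ _i : Fin d, 1 / (d : ℝ) := Finset.sum_le_sum fun i _ => ht.2 i
        _ = 1 := by simp; field_simp
    have hmem := hconv.sum_mem (t := Finset.univ)
      (w := fun o : Option (Fin d) => o.elim (1 - ∑ i, t i) t)
      (z := fun o : Option (Fin d) => o.elim x₀ fun i => x₀ + V i)
      (by rintro (_ | i) _
          · simpa using hsum
          · exact ht.1 i)
      (by simp [Fintype.sum_option])
      (by rintro (_ | i) _
          · exact hx₀
          · exact hV i)
    have e : x₀ + Matrix.toLin' V.transpose t =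
        ∑ o : Option (Fin d), (o.elim (1 - ∑ i, t i) t : ℝ) •
          (o.elim x₀ fun i => x₀ + V i : Fin d → ℝ) := by
      simp only [Fintype.sum_option, Option.elim, smul_add, Finset.sum_add_distrib]
      rw [← Finset.sum_smul, ← add_assoc, ← add_smul, sub_add_cancel, one_smul]
      congr 1
      rw [Matrix.toLin'_apply, Matrix.mulVec_transpose, Matrix.vecMul_eq_sum]
    change x₀ + Matrix.toLin' V.transpose t ∈ {x | δ ≤ f x}
    rw [e]; exact hmem
  have hvol : volume (Matrix.toLin' V.transpose '' box) =
      ENNReal.ofReal (|V.det| * (1 / d) ^ d) := by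
    rw [Measure.addHaar_image_linearMap, LinearMap.det_toLin', Matrix.det_transpose, hbox,
      Real.volume_Icc_pi, ENNReal.ofReal_mul (abs_nonneg _)]
    congr 1
    simp only [Pi.zero_apply, sub_zero, Finset.prod_const, Finset.card_univ, Fintype.card_fin]
    rw [ENNReal.ofReal_pow (by positivity)]
  have hle := measure_mono (μ := volume) hsub
  rw [hvol, measure_preimage_add] at hle
  rcases hδ.eq_or_lt with rfl | hδ0
  · simp
  have hfin : volume {x | δ ≤ f x} ≠ ⊤ := by
    have := hi.measure_norm_ge_lt_top hδ0
    simp_rw [Real.norm_of_nonneg (hf.1 _)] at this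
    exact this.ne
  have hreal : |V.det| * (1 / d) ^ d ≤ volume.real {x | δ ≤ f x} := by
    rw [Measure.real, ← ENNReal.ofReal_le_iff_le_toReal hfin]
    exact hle
  calc δ * (|V.det| * (1 / d) ^ d) ≤ δ * volume.real {x | δ ≤ f x} := by gcongr
    _ ≤ ∫ x, f x := mul_meas_ge_le_integral_of_nonneg (Filter.Eventually.of_forall hf.1) hi δ
    _ = 1 := h1

/-- Chebyshev's inequality at two standard deviations. -/
theorem slab_mass_ge (hf : IsLogConcaveFun f) (hi : Integrable f)
    (h1 : ∫ x, f x = 1) (hσ : 0 < σ)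
    (hcov : covMatrixFun f = σ ^ 2 • (1 : Matrix (Fin d) (Fin d) ℝ)) (i : Fin d) :
    3 / 4 ≤ ∫ x in {x : Fin d → ℝ | |LinearMap.proj (R := ℝ) i x - ∫ y, y i * f y| < 2 * σ},
      f x := by
  set a := ∫ y, y i * f y with ha
  obtain ⟨hI, hE⟩ := integral_sq_sub_mul hf.1 hi hσ h1 hcov (LinearMap.proj i) a
  simp only [LinearMap.proj_apply] at hI hE ⊢
  have hE' : ∫ x, (x i - a) ^ 2 * f x = σ ^ 2 := by
    rw [hE, ← ha]
    simp [Pi.single_apply]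
  have hA : MeasurableSet {x : Fin d → ℝ | |x i - a| < 2 * σ} :=
    (isOpen_lt (by fun_prop) continuous_const).measurableSet
  have htot := integral_add_compl hA hi
  rw [h1] at htot
  have : ∫ x in {x : Fin d → ℝ | |x i - a| < 2 * σ}ᶜ, f x ≤ 1 / 4 := by
    calc _ ≤ ∫ x in {x : Fin d → ℝ | |x i - a| < 2 * σ}ᶜ, 1 / (4 * σ ^ 2) * ((x i - a) ^ 2 * f x) := by
          refine setIntegral_mono_on hi.integrableOn (hI.const_mul _).integrableOn hA.compl
            fun x hx => ?_
          simp only [Set.mem_compl_iff, Set.mem_ofPred_eq, not_lt] at hx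
          have h2 : (2 * σ) ^ 2 ≤ (x i - a) ^ 2 := by
            rw [← sq_abs (x i - a)]; gcongr
          rw [← mul_assoc]
          refine le_mul_of_one_le_left (hf.1 x) ?_
          rw [one_div_mul_eq_div, one_le_div (by positivity)]
          linarith
      _ ≤ ∫ x, 1 / (4 * σ ^ 2) * ((x i - a) ^ 2 * f x) :=
          setIntegral_le_integral (hI.const_mul _) (Filter.Eventually.of_forall fun x =>
            mul_nonneg (by positivity) (mul_nonneg (sq_nonneg _) (hf.1 x)))
      _ = 1 / 4 := by rw [integral_const_mul, hE']; field_simp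
  linarith

end IsLogConcaveFun

/-! ### The exponential envelope and the conclusion -/

theorem integrable_and_integral_exp_neg_mul_abs_sub {κ : ℝ} (hκ : 0 < κ) (m : ℝ) :
    Integrable (fun t : ℝ => Real.exp (-(κ * |t - m|))) ∧
    ∫ t : ℝ, Real.exp (-(κ * |t - m|)) = 2 / κ := by
  have h : ∫ t : ℝ, Real.exp (-(κ * |t - m|)) = 2 / κ := by
    rw [integral_sub_right_eq_self (fun t => Real.exp (-(κ * |t|))) m,
      integral_comp_abs (f := fun t => Real.exp (-(κ * t)))]
    have := integral_exp_mul_Ioi (a := -κ) (by linarith) 0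
    simp only [neg_mul, mul_zero, Real.exp_zero] at this
    rw [this]
    field_simp
  refine ⟨Integrable.of_integral_ne_zero ?_, h⟩
  rw [h]; positivity

theorem quasiconcaveOn_exp_neg_mul_abs_sub {κ : ℝ} (hκ : 0 ≤ κ) (m : ℝ) :
    QuasiconcaveOn ℝ Set.univ fun t : ℝ => Real.exp (-(κ * |t - m|)) := by
  rw [quasiconcaveOn_iff_min_le]
  refine ⟨convex_univ, fun x _ y _ a b ha hb hab => ?_⟩
  have hmax : |a • x + b • y - m| ≤ max |x - m| |y - m| := by
    have e : a • x + b • y - m = a * (x - m) + b * (y - m) := by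
      have : m = (a + b) * m := by rw [hab, one_mul]
      simp only [smul_eq_mul]; linear_combination -this
    rw [e]
    calc |a * (x - m) + b * (y - m)| ≤ a * |x - m| + b * |y - m| := by
          refine (abs_add_le _ _).trans (le_of_eq ?_)
          rw [abs_mul, abs_mul, abs_of_nonneg ha, abs_of_nonneg hb]
      _ ≤ a * max |x - m| |y - m| + b * max |x - m| |y - m| := by
          gcongr
          · exact le_max_left _ _
          · exact le_max_right _ _
      _ = _ := by rw [← add_mul, hab, one_mul]
  rcases le_total |x - m| |y - m| with h | h
  · rw [max_eq_right h] at hmax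
    exact (min_le_right _ _).trans (by gcongr)
  · rw [max_eq_left h] at hmax
    exact (min_le_left _ _).trans (by gcongr)

/-- The profile is itself quasiconcave with maximum 1, so the one-variable comparison applies. -/
theorem summable_and_tsum_exp_neg_mul_abs_sub_le {κ : ℝ} (hκ : 0 < κ) (m : ℝ) :
    Summable (fun k : ℤ => Real.exp (-(κ * |(k : ℝ) - m|))) ∧
    ∑' k : ℤ, Real.exp (-(κ * |(k : ℝ) - m|)) ≤ 2 / κ + 1 := by
  obtain ⟨hi, hI⟩ := integrable_and_integral_exp_neg_mul_abs_sub hκ m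
  obtain ⟨hs, hS⟩ := (quasiconcaveOn_exp_neg_mul_abs_sub hκ.le m).abs_integral_sub_tsum_int_le
    (B := 1) (fun t => (Real.exp_pos _).le)
    (fun t => Real.exp_le_one_iff.2 (neg_nonpos.2 (by positivity))) hi
  rw [hI] at hS
  exact ⟨hs, by linarith [(abs_le.1 hS).1]⟩

/-- The largest `u i` is at least the average, so the best of the bounds is at most their geometric
mean. -/
theorem le_prod_exp_of_forall_le {d : ℕ} (hd : 1 ≤ d) {y B c : ℝ} {u : Fin d → ℝ} (hB : 0 ≤ B)
    (hc : 0 ≤ c) (h : ∀ i, y ≤ B * Real.exp (-(c * u i))) :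
    y ≤ B * ∏ i, Real.exp (-(c / d * u i)) := by
  have hd0 : (0 : ℝ) < d := by exact_mod_cast hd
  have : Nonempty (Fin d) := ⟨⟨0, hd⟩⟩
  obtain ⟨i, -, hi⟩ := Finset.exists_max_image Finset.univ u Finset.univ_nonempty
  refine (h i).trans ?_
  rw [← Real.exp_sum]
  gcongr
  rw [Finset.sum_neg_distrib, neg_le_neg_iff, ← Finset.mul_sum]
  have : ∑ j, u j ≤ d * u i := by
    have := Finset.sum_le_card_nsmul Finset.univ u (u i) hi
    simpa using this
  calc c / d * ∑ j, u j ≤ c / d * (d * u i) := by gcongr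
    _ = c * u i := by field_simp

/-- For log-concave densities `f` on `ℝ^d` with covariance matrix `σ² I_d`, the sum of `f` over
`ℤ^d` converges and differs from the integral of `f` by `O_d(1/σ)`: the constants `C` and `N`
depend only on `d`, and the bound holds for every such `f` with `σ ≥ N`. -/
theorem mainTheorem5 (d : ℕ) (hd : 1 ≤ d) :
    ∃ C N : ℝ, 0 < C ∧ 0 < N ∧
      ∀ (f : (Fin d → ℝ) → ℝ) (σ : ℝ),
        IsLogConcaveFun f → IsDensityFun f → 0 < σ →
        covMatrixFun f = σ ^ 2 • (1 : Matrix (Fin d) (Fin d) ℝ) →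
        N ≤ σ →
          Summable (fun k : Fin d → ℤ => f (fun i => (k i : ℝ))) ∧
          |(∫ x, f x) - ∑' k : Fin d → ℤ, f (fun i => (k i : ℝ))| ≤ C / σ := by
  have hd0 : (0 : ℝ) < d := by exact_mod_cast hd
  have hL : 0 < Real.log (4 / 3) := Real.log_pos (by norm_num)
  obtain ⟨ε, hε⟩ : ∃ ε : ℝ, ε = (1 / (8 * (8 / 3) ^ d)) ^ 2 := ⟨_, rfl⟩
  obtain ⟨c, hc⟩ : ∃ c : ℝ, c = Real.log (4 / 3) / (64 * 2 ^ d) := ⟨_, rfl⟩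
  obtain ⟨Q, hQ⟩ : ∃ Q : ℝ, Q = 2 / (Real.log (4 / 3) / 16 / d) + 1 := ⟨_, rfl⟩
  have hε0 : 0 < ε := by rw [hε]; positivity
  have hc0 : 0 < c := by rw [hc]; positivity
  have hQ0 : 0 < Q := by rw [hQ]; positivity
  refine ⟨d * (4 / 3) ^ d * Q ^ (d - 1) * (1 / (ε * (c / d) ^ d)), 1, by positivity, one_pos, ?_⟩
  rintro f σ hf ⟨-, hi, h1⟩ hσ hcov hσ1
  have hbdd := hf.bddAbove hi h1
  obtain ⟨M, hMdef⟩ : ∃ M : ℝ, M = ⨆ x, f x := ⟨_, rfl⟩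
  have hM : ∀ x, f x ≤ M := fun x => hMdef ▸ le_ciSup hbdd x
  have hM0 : 0 < M := by
    by_contra! h
    have : ∫ x, f x ≤ 0 := integral_nonpos fun x => (hM x).trans h
    linarith
  have hK1 : 1 < (4 / 3 : ℝ) ^ d := one_lt_pow₀ (by norm_num) (by omega)
  -- The supremum need not be attained; a point within the factor `(4 / 3) ^ d` suffices.
  obtain ⟨x₀, hx₀⟩ : ∃ x₀, M ≤ (4 / 3) ^ d * f x₀ := by
    obtain ⟨x, hx⟩ := exists_lt_of_lt_ciSup
      (show M / (4 / 3) ^ d < ⨆ x, f x by rw [← hMdef]; exact div_lt_self hM0 hK1)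
    refine ⟨x, ?_⟩
    rw [div_lt_iff₀ (by positivity)] at hx
    linarith
  have hεx₀ : ε * M ≤ f x₀ := by
    have hle : ε * (4 / 3) ^ d ≤ 1 := by
      rw [hε, one_div, inv_pow, inv_mul_eq_div, div_le_one (by positivity)]
      have h1 : (4 / 3 : ℝ) ^ d ≤ (8 / 3) ^ d := by gcongr; norm_num
      nlinarith
    calc ε * M ≤ ε * ((4 / 3) ^ d * f x₀) := by gcongr
      _ = ε * (4 / 3) ^ d * f x₀ := by ring
      _ ≤ 1 * f x₀ := mul_le_mul_of_nonneg_right hle (hf.1 x₀)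
      _ = f x₀ := one_mul _
  obtain ⟨V, hV1, -, hV3⟩ :=
    hf.exists_matrix_det_ge hd hi h1 hσ hcov hM0 hM hx₀ Finset.univ
  rw [← hc, Finset.card_univ, Fintype.card_fin] at hV3
  rw [← hε] at hV1
  have hbound := hf.mul_le_one_of_matrix hi h1 hεx₀ (by positivity) V
    fun i => hV1 i (Finset.mem_univ i)
  have hMσ : M * σ ^ d ≤ 1 / (ε * (c / d) ^ d) := by
    rw [le_div_iff₀ (by positivity)]
    calc M * σ ^ d * (ε * (c / d) ^ d) = ε * M * ((c * σ) ^ d * (1 / d) ^ d) := by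
          rw [mul_pow, div_pow, div_pow, one_pow]; ring
      _ ≤ ε * M * (|V.det| * (1 / d) ^ d) := by gcongr
      _ ≤ 1 := hbound
  set κ : ℝ := Real.log (4 / 3) / 8 / (2 * σ) / d with hκ
  have hκ0 : 0 < κ := by positivity
  -- Here `σ ≥ N = 1` absorbs the additive 1 of the lattice sum into a multiple of `σ`.
  have hS : 2 / κ + 1 ≤ Q * σ := by
    have : 2 / κ = 2 / (Real.log (4 / 3) / 16 / d) * σ := by rw [hκ]; field_simp; norm_num
    rw [this, hQ, add_mul, one_mul]
    gcongr
  have hdom : ∀ x, f x ≤ M * (4 / 3) ^ d *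
      ∏ i, Real.exp (-(κ * |x i - ∫ y, y i * f y|)) := fun x =>
    le_prod_exp_of_forall_le hd (by positivity) (by positivity) fun i =>
      hf.le_exp_of_slab hd hi h1 hM0 hM hx₀ (LinearMap.proj i) (by positivity)
        (hf.slab_mass_ge hi h1 hσ hcov i) x
  obtain ⟨hs, hle⟩ := QuasiconcaveOn.abs_integral_sub_tsum_pi_int_le
    (S := Q * σ) (by positivity) d f
    (fun i t => Real.exp (-(κ * |t - ∫ y, y i * f y|))) (M * (4 / 3) ^ d)
    hf.quasiconcaveOn hf.1 (by positivity) (fun i t => (Real.exp_pos _).le)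
    (fun i t => Real.exp_le_one_iff.2 (neg_nonpos.2 (by positivity)))
    (fun i => (integrable_and_integral_exp_neg_mul_abs_sub hκ0 _).1)
    (fun i => by
      rw [(integrable_and_integral_exp_neg_mul_abs_sub hκ0 _).2]
      linarith)
    (fun i => (summable_and_tsum_exp_neg_mul_abs_sub_le hκ0 _).1)
    (fun i => (summable_and_tsum_exp_neg_mul_abs_sub_le hκ0 _).2.trans hS) hdom
  refine ⟨hs, hle.trans ?_⟩
  rw [le_div_iff₀ hσ]
  have hσd : σ ^ d = σ ^ (d - 1) * σ := by rw [← pow_succ, Nat.sub_add_cancel hd]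
  calc d * (M * (4 / 3) ^ d) * (Q * σ) ^ (d - 1) * σ
      = d * (4 / 3) ^ d * Q ^ (d - 1) * (M * σ ^ d) := by rw [hσd, mul_pow]; ring
    _ ≤ _ := by gcongr
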